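/- Let $\Lambda=\mathbb Z[t,t^{-1}]$. For a finitely generated $\Lambda$-module $M$, let $zM$ be its maximal finite submodule and $\bar M=M/zM$. If $M$ is isomorphic to the cokernel of a homomorphism $\Lambda^r\to\Lambda^s$, $r\ge s$, given by an $r\times s$ matrix $A$ over $\Lambda$, then the order $\Delta(M)$ is the greatest common divisor of the $s\times s$ minors of $A$; it is well defined up to multiplication by units $\pm t^i$ of $\Lambda$. For abelian groups $U,B$ and monomorphisms $f,g\colon U\to B$, the infinite amalgamated sum $$\cdots\oplus_U B\oplus_U B\oplus_U\cdots$$ is the quotient of the direct sum $\bigoplus_{n\in\mathbb Z}B_n$ of copies $B_n=B$ by the subgroup generated by all elements $f(u)_n-g(u)_{n+1}$ with $u\in U$, $n\in\mathbb Z$, where $b_n$ denotes the element $b\in B$ in the $n$-th summand. It is a $\Lambda$-module in which $t$ acts as the shift $b_n\mapsto b_{n+1}$. Corollary. Let $M$ be a finitely generated $\Lambda$-module with $\Delta(M)=c_0+c_1t+\cdots+c_dt^d$ for a representative with $c_i\in\mathbb Z$, $d\ge 0$, $c_0c_d\neq 0$ and $\gcd(c_0,\ldots,c_d)=1$. Then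 there exist monomorphisms $f,g\colon\mathbb Z^d\to\mathbb Z^d$ such that 1. $\bar M$ is isomorphic, as a $\Lambda$-module, to the infinite amalgamated sum $\cdots\oplus_{\mathbb Z^d}\mathbb Z^d\oplus_{\mathbb Z^d}\mathbb Z^d\oplus_{\mathbb Z^d}\cdots$ formed with $f$ and $g$; 2. $\Delta(M)=\det(tg-f)$ up to multiplication by a unit of $\Lambda$; 3. $|c_0|=[\mathbb Z^d:f(\mathbb Z^d)]$ and $|c_d|=[\mathbb Z^d:g(\mathbb Z^d)]$. -/

import Mathlib

open scoped LaurentPolynomial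

noncomputable section

namespace LaurentModule

/-! ### The order of a finitely generated module over the ring of integral Laurent polynomials -/

/-- `A` is a presentation matrix of `M`: the module `M` is isomorphic to the cokernel of the
homomorphism from `Λ^r` to `Λ^s` given by the `r × s` matrix `A` (acting on row vectors). -/
def IsPresentationMatrix (M : Type*) [AddCommGroup M] [Module ℤ[T;T⁻¹] M] {r s : ℕ}
    (A : Matrix (Fin r) (Fin s) ℤ[T;T⁻¹]) : Prop :=
  Nonempty (((Fin s → ℤ[T;T⁻¹]) ⧸ LinearMap.range A.vecMulLinear) ≃ₗ[ℤ[T;T⁻¹]] M)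

/-- `δ` is an order of `M`: it is a greatest common divisor of the `s × s` minors of an `r × s`
presentation matrix of `M` with `s ≤ r`. A minor is obtained by choosing `s` distinct rows; the
ordering of the rows only affects its sign. -/
def IsOrder (M : Type*) [AddCommGroup M] [Module ℤ[T;T⁻¹] M] (δ : ℤ[T;T⁻¹]) : Prop :=
  ∃ (r s : ℕ) (A : Matrix (Fin r) (Fin s) ℤ[T;T⁻¹]), s ≤ r ∧ IsPresentationMatrix M A ∧
    ∀ x : ℤ[T;T⁻¹], x ∣ δ ↔ ∀ ρ : Fin s ↪ Fin r, x ∣ (A.submatrix ρ id).det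

/-! ### The maximal finite submodule -/

/-- The maximal finite submodule `zM` of `M`, as the sum of all finite submodules. -/
def maxFinite (M : Type*) [AddCommGroup M] [Module ℤ[T;T⁻¹] M] : Submodule ℤ[T;T⁻¹] M :=
  sSup {N : Submodule ℤ[T;T⁻¹] M | Finite N}

/-- For a finitely generated module, `zM` is indeed the largest finite submodule. -/
theorem maxFinite_isGreatest (M : Type*) [AddCommGroup M] [Module ℤ[T;T⁻¹] M]
    [Module.Finite ℤ[T;T⁻¹] M] :
    IsGreatest {N : Submodule ℤ[T;T⁻¹] M | Finite N} (maxFinite M) := by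
  refine ⟨?_, fun N hN => le_sSup hN⟩
  have : IsNoetherianRing ℤ[T;T⁻¹] :=
    IsLocalization.isNoetherianRing (Submonoid.powers (Polynomial.X : Polynomial ℤ)) _ inferInstance
  have : IsNoetherian ℤ[T;T⁻¹] M := isNoetherian_of_isNoetherianRing_of_finite _ _
  have hsup : SupClosed {N : Submodule ℤ[T;T⁻¹] M | Finite N} := by
    intro P hP Q hQ
    have hP' : (P : Set M).Finite := hP
    have hQ' : (Q : Set M).Finite := hQ
    have : ((P ⊔ Q : Submodule ℤ[T;T⁻¹] M) : Set M).Finite := by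
      rw [Submodule.coe_sup]
      exact hP'.add hQ'
    exact this
  have hne : {N : Submodule ℤ[T;T⁻¹] M | Finite N}.Nonempty :=
    ⟨⊥, show Finite (⊥ : Submodule ℤ[T;T⁻¹] M) from inferInstance⟩
  exact CompleteLattice.WellFoundedGT.isSupClosedCompact _ inferInstance _ hne hsup

/-! ### The infinite amalgamated sum -/

section Amalgam

variable {U B : Type*} [AddCommGroup U] [AddCommGroup B]

/-- The subgroup of the direct sum of copies `B_n` of `B`, for `n` an integer, that is generated by
the elements `f(u)_n - g(u)_(n+1)`. -/
def amalgamRelators (f g : U →+ B) : AddSubgroup (ℤ →₀ B) :=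
  AddSubgroup.closure
    {x | ∃ (n : ℤ) (u : U), x = Finsupp.single n (f u) - Finsupp.single (n + 1) (g u)}

/-- The infinite amalgamated sum of copies `B_n` of `B`, for `n` an integer: for each `n` the
consecutive factors `B_n` and `B_(n+1)` are amalgamated along `U`, which is mapped to `B_n` by `f`
and to `B_(n+1)` by `g`. -/
def Amalgam (f g : U →+ B) : Type _ := (ℤ →₀ B) ⧸ amalgamRelators f g

instance (f g : U →+ B) : AddCommGroup (Amalgam f g) :=
  inferInstanceAs (AddCommGroup ((ℤ →₀ B) ⧸ amalgamRelators f g))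

/-- The natural map of the `n`-th factor `B_n` to the amalgamated sum. -/
def Amalgam.of (f g : U →+ B) (n : ℤ) (b : B) : Amalgam f g :=
  QuotientAddGroup.mk' (amalgamRelators f g) (Finsupp.single n b)

/-- The shift of the coordinates of the direct sum one place to the right. -/
def shiftSum (B : Type*) [AddCommGroup B] : (ℤ →₀ B) ≃+ (ℤ →₀ B) :=
  Finsupp.domCongr (Equiv.addRight (1 : ℤ))

theorem shiftSum_single (n : ℤ) (b : B) :
    shiftSum B (Finsupp.single n b) = Finsupp.single (n + 1) b := by
  simp [shiftSum]

theorem map_shiftSum_relators (f g : U →+ B) :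
    (amalgamRelators f g).map (shiftSum B : (ℤ →₀ B) →+ (ℤ →₀ B)) = amalgamRelators f g := by
  rw [amalgamRelators, AddMonoidHom.map_closure]
  congr 1
  ext x
  constructor
  · rintro ⟨_, ⟨n, u, rfl⟩, rfl⟩
    exact ⟨n + 1, u, by simp [shiftSum_single]⟩
  · rintro ⟨n, u, rfl⟩
    exact ⟨_, ⟨n - 1, u, rfl⟩, by simp [shiftSum_single]⟩

/-- The automorphism `μ` of the amalgamated sum that shifts the coordinates one place to the
right. -/
def Amalgam.shift (f g : U →+ B) : Amalgam f g ≃+ Amalgam f g :=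
  QuotientAddGroup.congr (amalgamRelators f g) (amalgamRelators f g) (shiftSum B)
    (map_shiftSum_relators f g)

/-- The action of the Laurent polynomials on the amalgamated sum in which `t^n` acts as the `n`-th
power of the shift `μ`. -/
def Amalgam.action (f g : U →+ B) : ℤ[T;T⁻¹] →ₐ[ℤ] Module.End ℤ (Amalgam f g) :=
  AddMonoidAlgebra.lift ℤ (Module.End ℤ (Amalgam f g)) ℤ
    ((LinearEquiv.automorphismGroup.toLinearMapMonoidHom).comp
      (zpowersHom (Amalgam f g ≃ₗ[ℤ] Amalgam f g) (Amalgam.shift f g).toIntLinearEquiv))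

instance (f g : U →+ B) : Module ℤ[T;T⁻¹] (Amalgam f g) :=
  Module.compHom (Amalgam f g) (Amalgam.action f g).toRingHom

theorem Amalgam.T_smul (f g : U →+ B) (x : Amalgam f g) :
    (LaurentPolynomial.T 1 : ℤ[T;T⁻¹]) • x = Amalgam.shift f g x := by
  change AddMonoidAlgebra.lift ℤ (Module.End ℤ (Amalgam f g)) ℤ _
    (AddMonoidAlgebra.single (1 : ℤ) (1 : ℤ)) x = _
  rw [AddMonoidAlgebra.lift_single, one_smul]
  simp [LinearEquiv.automorphismGroup.toLinearMapMonoidHom]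
  rfl

theorem Amalgam.T_smul_of (f g : U →+ B) (n : ℤ) (b : B) :
    (LaurentPolynomial.T 1 : ℤ[T;T⁻¹]) • Amalgam.of f g n b = Amalgam.of f g (n + 1) b := by
  rw [Amalgam.T_smul]
  change QuotientAddGroup.mk' (amalgamRelators f g) (shiftSum B (Finsupp.single n b)) = _
  rw [shiftSum_single]
  rfl

theorem Amalgam.of_eq_of (f g : U →+ B) (n : ℤ) (u : U) :
    Amalgam.of f g n (f u) = Amalgam.of f g (n + 1) (g u) := by
  have h : Finsupp.single n (f u) - Finsupp.single (n + 1) (g u) ∈ amalgamRelators f g :=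
    AddSubgroup.subset_closure ⟨n, u, rfl⟩
  have h' := (QuotientAddGroup.eq_zero_iff _).mpr h
  exact sub_eq_zero.mp h'

end Amalgam

/-- The matrix `tg - f` with entries in the Laurent polynomials, for endomorphisms `f`, `g` of the
lattice of rank `d`, with respect to the standard basis. -/
def pencil {d : ℕ} (f g : (Fin d → ℤ) →+ (Fin d → ℤ)) : Matrix (Fin d) (Fin d) ℤ[T;T⁻¹] :=
  Matrix.of fun i j =>
    LaurentPolynomial.T 1 * LaurentPolynomial.C (g (Pi.single j 1) i) -
      LaurentPolynomial.C (f (Pi.single j 1) i)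

end LaurentModule

end

/-! Write `N` for `M/zM`. For each prime `p`, primitivity of `Δ(M)` gives an element of the Fitting
ideal of `M` that `p` does not divide, and this element kills `M`. A `p`-torsion element of `N`
therefore generates a quotient of `𝔽_p[t,t⁻¹]/(h)` with `h ≠ 0`, which is finite, so the element
vanishes: `N` is torsion-free over `ℤ` (`isTorsionFree_quotient_maxFinite`).

Let `E` be the subgroup spanned by finitely many `Λ`-generators of `N`, and `E_k = E + tE + ⋯ + t^k
E`. For large `k` take `U = E_k`, `B = E_{k+1}`, with `g` the inclusion and `f` multiplication by
`t`. The leading coefficient of an annihilating polynomial carries `B` into `U`, so both are free of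
the same rank `e`. A Noetherian argument shows that relations among the translates `t^n B` come only
from neighbours (`exists_lattice`), so `N` is the amalgamated sum (`nonempty_amalgam_equiv`).

Hence `tg - f` presents `N`, and the Fitting ideal of `N` is generated by `det(tg - f)`. Fitting
ideals do not depend on generators (`fittingIdeal_eq_of_span_eq_top`), and dividing out `zM` does
not change the greatest common divisor, since `Δ(M)` is coprime to `|zM|`
(`dvd_fittingIdeal_mkQ_iff`). So `Δ(M)` and `det(tg - f)` are associated. Comparing degrees gives `e
= d`; the extreme coefficients of the determinant are `±det f` and `det g`, whose absolute values
are the indices. -/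

noncomputable section

namespace LaurentModule

open Polynomial (toLaurent)

/-! ### Fitting ideals -/

section Fitting

variable {R M : Type*} [CommRing R] [AddCommGroup M] [Module R M]

/-- The ideal generated by the determinants of the square matrices whose rows are relations
between the members of the family `x`. -/
def fittingIdeal {n : ℕ} (x : Fin n → M) : Ideal R :=
  Ideal.span {a | ∃ V : Matrix (Fin n) (Fin n) R, (∀ i, ∑ j, V i j • x j = 0) ∧ V.det = a}

theorem det_mem_fittingIdeal {n : ℕ} {x : Fin n → M} {V : Matrix (Fin n) (Fin n) R}
    (hV : ∀ i, ∑ j, V i j • x j = 0) : V.det ∈ fittingIdeal (R := R) x :=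
  Ideal.subset_span ⟨V, hV, rfl⟩

theorem dvd_fittingIdeal_iff {n : ℕ} {x : Fin n → M} {a : R} :
    (∀ y ∈ fittingIdeal (R := R) x, a ∣ y) ↔
      ∀ V : Matrix (Fin n) (Fin n) R, (∀ i, ∑ j, V i j • x j = 0) → a ∣ V.det := by
  refine ⟨fun h V hV => h _ (det_mem_fittingIdeal hV), fun h y hy => ?_⟩
  have : fittingIdeal (R := R) x ≤ Ideal.span {a} := by
    refine Ideal.span_le.mpr ?_
    rintro _ ⟨V, hV, rfl⟩
    exact Ideal.mem_span_singleton.mpr (h V hV)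
  exact Ideal.mem_span_singleton.mp (this hy)

/-- With `y = ∑ a j • x j`, column operations eliminate `y` from the relations, and expansion along
its column leaves minors formed by relations of `x`. Conversely, a relation matrix of `x` is
bordered by the row `(1, -a)`. -/
theorem fittingIdeal_cons {n : ℕ} (x : Fin n → M) {y : M}
    (hy : y ∈ Submodule.span R (Set.range x)) :
    fittingIdeal (R := R) (Fin.cons y x : Fin (n + 1) → M) = fittingIdeal x := by
  obtain ⟨a, ha⟩ := (Submodule.mem_span_range_iff_exists_fun R).mp hy
  apply le_antisymm
  · refine Ideal.span_le.mpr ?_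
    rintro _ ⟨V, hV, rfl⟩
    let c : Fin (n + 1) → R := Fin.cons 0 a
    let W : Matrix (Fin (n + 1)) (Fin (n + 1)) R := .of fun i j => V i j + c j * V i 0
    have hdet : V.det = W.det := by
      rw [← Matrix.det_transpose V, ← Matrix.det_transpose W]
      exact (Matrix.det_eq_of_forall_row_eq_smul_add_const c 0 rfl fun i j => rfl).symm
    rw [hdet, Matrix.det_succ_column_zero]
    refine Ideal.sum_mem _ fun i _ => Ideal.mul_mem_left _ _ (det_mem_fittingIdeal fun k => ?_)
    have := hV (i.succAbove k)
    rw [Fin.sum_univ_succ] at this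
    simp only [Fin.cons_zero, Fin.cons_succ, ← ha] at this
    simp only [Matrix.submatrix_apply, W, c, Matrix.of_apply, Fin.cons_succ, add_smul,
      Finset.sum_add_distrib]
    rw [← this, Finset.smul_sum, add_comm]
    simp only [mul_comm (a _), mul_smul]
  · refine Ideal.span_le.mpr ?_
    rintro _ ⟨V, hV, rfl⟩
    let W : Matrix (Fin (n + 1)) (Fin (n + 1)) R :=
      .of (Fin.cons (Fin.cons 1 (-a)) fun i => Fin.cons 0 (V i))
    have hdet : V.det = W.det := by
      rw [Matrix.det_succ_column_zero W, Fin.sum_univ_succ]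
      have : W.submatrix (Fin.succAbove 0) Fin.succ = V := by ext i j; simp [W]
      simp [W] at this ⊢
      rw [this]
    rw [hdet]
    refine det_mem_fittingIdeal fun i => ?_
    rw [Fin.sum_univ_succ]
    refine Fin.cases ?_ (fun i => ?_) i
    · simp [W, ha]
    · simpa [W] using hV i

theorem fittingIdeal_comp_equiv {m n : ℕ} (e : Fin m ≃ Fin n) (x : Fin n → M) :
    fittingIdeal (R := R) (x ∘ e) = fittingIdeal x := by
  have key : ∀ {m n : ℕ} (e : Fin m ≃ Fin n) (x : Fin n → M),
      fittingIdeal (R := R) (x ∘ e) ≤ fittingIdeal x := by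
    intro m n e x
    refine Ideal.span_le.mpr ?_
    rintro _ ⟨V, hV, rfl⟩
    rw [← Matrix.det_submatrix_equiv_self e.symm V]
    refine det_mem_fittingIdeal fun i => ?_
    rw [← hV (e.symm i), ← e.sum_comp]
    simp
  refine le_antisymm (key e x) ?_
  have := key e.symm (x ∘ e)
  rwa [Function.comp_assoc, e.self_comp_symm, Function.comp_id] at this

theorem fittingIdeal_append {m n : ℕ} (y : Fin m → M) (x : Fin n → M)
    (hy : ∀ i, y i ∈ Submodule.span R (Set.range x)) :
    fittingIdeal (R := R) (Fin.append y x) = fittingIdeal x := by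
  induction m with
  | zero =>
    rw [show y = Fin.elim0 from Subsingleton.elim _ _, Fin.elim0_append]
    exact fittingIdeal_comp_equiv (finCongr (zero_add n)) x
  | succ m ih =>
    rw [← Fin.cons_self_tail y, Fin.append_cons,
      ← ih (Fin.tail y) fun i => hy i.succ, ← fittingIdeal_cons (Fin.append (Fin.tail y) x)]
    · exact fittingIdeal_comp_equiv (finCongr (Nat.succ_add m n)) _
    · refine Submodule.span_mono ?_ (hy 0)
      rintro _ ⟨i, rfl⟩
      exact ⟨Fin.natAdd m i, by simp⟩

/-- The Fitting ideal does not depend on the choice of the generators. -/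
theorem fittingIdeal_eq_of_span_eq_top {m n : ℕ} (y : Fin m → M) (x : Fin n → M)
    (hy : Submodule.span R (Set.range y) = ⊤) (hx : Submodule.span R (Set.range x) = ⊤) :
    fittingIdeal (R := R) y = fittingIdeal x := by
  rw [← fittingIdeal_append y x (by simp [hx]), ← fittingIdeal_append x y (by simp [hy]),
    ← fittingIdeal_comp_equiv finAddFlip]
  congr 1
  ext i
  refine Fin.addCases (fun i => ?_) (fun i => ?_) i <;> simp

/-- Cramer's rule: multiplying the relations by the adjugate of `V` shows that `V.det` kills each
generator. -/
theorem fittingIdeal_smul_eq_zero {n : ℕ} (x : Fin n → M)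
    (hx : Submodule.span R (Set.range x) = ⊤) {a : R} (ha : a ∈ fittingIdeal (R := R) x) (y : M) :
    a • y = 0 := by
  have h : fittingIdeal (R := R) x ≤ Module.annihilator R M := by
    refine Ideal.span_le.mpr ?_
    rintro _ ⟨V, hV, rfl⟩
    refine Module.mem_annihilator.mpr fun z => ?_
    have hz : z ∈ Submodule.span R (Set.range x) := hx ▸ Submodule.mem_top
    induction hz using Submodule.span_induction with
    | mem z hz =>
      obtain ⟨k, rfl⟩ := hz
      have h1 : ∑ i, V.adjugate k i • ∑ j, V i j • x j = V.det • x k := by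
        simp only [Finset.smul_sum, smul_smul]
        rw [Finset.sum_comm]
        simp only [← Finset.sum_smul, ← Matrix.mul_apply, Matrix.adjugate_mul]
        simp [Matrix.one_apply, ite_smul]
      rw [← h1]
      simp [hV]
    | zero => simp
    | add u v _ _ hu hv => rw [smul_add, hu, hv, add_zero]
    | smul b u _ hu => rw [smul_comm, hu, smul_zero]
  exact Module.mem_annihilator.mp (h ha) y

/-- A common divisor of the maximal minors of `A` divides the determinant of every square matrix
whose rows are combinations of the rows of `A`. -/
theorem dvd_det_mul_of_dvd_minors {r s : ℕ} (A : Matrix (Fin r) (Fin s) R) {a : R}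
    (h : ∀ ρ : Fin s ↪ Fin r, a ∣ (A.submatrix ρ id).det) (X : Matrix (Fin s) (Fin r) R) :
    a ∣ (X * A).det := by
  have h1 : X * A = fun i => ∑ k, X i k • A k := by
    ext i j
    simp [Matrix.mul_apply]
  have h2 : (X * A).det = Matrix.detRowAlternating.toMultilinearMap
      fun i => ∑ k, X i k • A k := by rw [h1]; rfl
  -- The multilinear expansion runs over all maps `ρ`; those that are not injective repeat a row and
  -- contribute zero.
  rw [h2, MultilinearMap.map_sum]
  refine Finset.dvd_sum fun ρ _ => ?_
  rw [MultilinearMap.map_smul_univ]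
  refine Dvd.dvd.mul_left ?_ _
  by_cases hρ : Function.Injective ρ
  · exact h ⟨ρ, hρ⟩
  · obtain ⟨i, j, hij, hne⟩ := Function.not_injective_iff.mp hρ
    change a ∣ (A.submatrix ρ id).det
    rw [Matrix.det_zero_of_row_eq hne (by ext; simp [hij])]
    exact dvd_zero a

theorem dvd_fittingIdeal_iff_dvd_minors {r s : ℕ} (A : Matrix (Fin r) (Fin s) R) (x : Fin s → M)
    (hx : ∀ v : Fin s → R, ∑ j, v j • x j = 0 ↔ v ∈ LinearMap.range A.vecMulLinear) {a : R} :
    (∀ y ∈ fittingIdeal (R := R) x, a ∣ y) ↔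
      ∀ ρ : Fin s ↪ Fin r, a ∣ (A.submatrix ρ id).det := by
  rw [dvd_fittingIdeal_iff]
  constructor
  · refine fun h ρ => h _ fun i => (hx _).mpr ⟨Pi.single (ρ i) 1, ?_⟩
    ext j
    simp
  · intro h V hV
    choose X hX using fun i => (hx (V i)).mp (hV i)
    have : V = Matrix.of X * A := by
      ext i j
      rw [← hX i]
      rfl
    rw [this]
    exact dvd_det_mul_of_dvd_minors A h _

theorem fittingIdeal_eq_span_det {n : ℕ} (A : Matrix (Fin n) (Fin n) R) (x : Fin n → M)
    (hx : ∀ v : Fin n → R, ∑ j, v j • x j = 0 ↔ v ∈ LinearMap.range A.vecMulLinear) :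
    fittingIdeal (R := R) x = Ideal.span {A.det} := by
  apply le_antisymm
  · refine Ideal.span_le.mpr ?_
    rintro _ ⟨V, hV, rfl⟩
    choose X hX using fun i => (hx (V i)).mp (hV i)
    have : V = Matrix.of X * A := by
      ext i j
      rw [← hX i]
      rfl
    rw [this, Matrix.det_mul]
    exact Ideal.mem_span_singleton.mpr (Dvd.intro_left _ rfl)
  · rw [Ideal.span_singleton_le_iff_mem]
    refine det_mem_fittingIdeal fun i => (hx _).mpr ⟨Pi.single i 1, ?_⟩
    ext j
    simp

end Fitting

/-! ### Divisibility by integers -/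

theorem C_dvd_toLaurent_iff {n : ℤ} {q : Polynomial ℤ} :
    LaurentPolynomial.C n ∣ toLaurent q ↔ Polynomial.C n ∣ q := by
  constructor
  · rintro ⟨g, hg⟩
    rw [Polynomial.C_dvd_iff_dvd_coeff]
    intro k
    rw [← LaurentPolynomial.smul_eq_C_mul] at hg
    have h1 : (toLaurent q).coeff (k : ℤ) = q.coeff k := by
      rw [LaurentPolynomial.coeff_toLaurent]
      exact Finsupp.mapDomain_apply Nat.cast_injective _ _
    rw [← h1, hg]
    exact ⟨g.coeff k, rfl⟩
  · rintro ⟨g, rfl⟩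
    rw [map_mul, Polynomial.toLaurent_C]
    exact dvd_mul_right _ _

/-- Powers of `t` are units, so both factors may be moved into `ℤ[t]`, where a prime of `ℤ` stays
prime. -/
theorem prime_C {p : ℤ} (hp : Prime p) : Prime (LaurentPolynomial.C p : ℤ[T;T⁻¹]) := by
  refine ⟨?_, ?_, ?_⟩
  · rw [← Polynomial.toLaurent_C, Polynomial.toLaurent_ne_zero, Polynomial.C_ne_zero]
    exact hp.ne_zero
  · intro h
    have h1 : LaurentPolynomial.C p ∣ toLaurent (1 : Polynomial ℤ) := h.dvd
    rw [C_dvd_toLaurent_iff] at h1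
    exact (Polynomial.prime_C_iff.mpr hp).not_isUnit (isUnit_of_dvd_one h1)
  · intro a b hab
    obtain ⟨m, q, hq⟩ := a.exists_T_pow
    obtain ⟨n, r, hr⟩ := b.exists_T_pow
    have hm := LaurentPolynomial.isUnit_T (R := ℤ) m
    have hn := LaurentPolynomial.isUnit_T (R := ℤ) n
    have h1 : LaurentPolynomial.C p ∣ toLaurent (q * r) := by
      rw [map_mul, hq, hr]
      refine hab.trans ⟨LaurentPolynomial.T m * LaurentPolynomial.T n, by ring⟩
    rw [C_dvd_toLaurent_iff] at h1
    rw [← hm.dvd_mul_right, ← hq, ← hn.dvd_mul_right (a := _) (b := b), ← hr,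
      C_dvd_toLaurent_iff, C_dvd_toLaurent_iff]
    exact (Polynomial.prime_C_iff.mpr hp).dvd_or_dvd h1

/-- A Laurent polynomial without integral prime divisors is coprime to all positive integers. -/
theorem dvd_of_dvd_C_mul {δ : ℤ[T;T⁻¹]}
    (hδ : ∀ p : ℕ, p.Prime → ¬ LaurentPolynomial.C (p : ℤ) ∣ δ) {n : ℕ} (hn : n ≠ 0)
    {y : ℤ[T;T⁻¹]} (h : δ ∣ LaurentPolynomial.C (n : ℤ) * y) : δ ∣ y := by
  induction n using induction_on_primes generalizing y with
  | zero => exact absurd rfl hn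
  | one => simpa using h
  | prime_mul p a hp ih =>
    have hpC := prime_C (Nat.prime_iff_prime_int.mp hp)
    refine ih (by rintro rfl; simp at hn) ?_
    obtain ⟨z, hz⟩ := h
    rw [Nat.cast_mul, map_mul, mul_assoc] at hz
    obtain ⟨w, rfl⟩ := (hpC.dvd_or_dvd (Dvd.intro _ hz)).resolve_left (hδ p hp)
    refine ⟨w, mul_left_cancel₀ hpC.ne_zero ?_⟩
    rw [hz]
    ring

variable {N : Type*} [AddCommGroup N] [Module ℤ[T;T⁻¹] N]

theorem C_smul (n : ℤ) (x : N) : (LaurentPolynomial.C n : ℤ[T;T⁻¹]) • x = n • x := by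
  rw [← Int.cast_smul_eq_zsmul ℤ[T;T⁻¹] n x]
  congr 1

/-! ### Torsion-freeness of the quotient by the maximal finite submodule -/

theorem finite_span_singleton {p : ℕ} (hp : p.Prime) {x : N} (hx : (p : ℤ) • x = 0)
    {h : ℤ[T;T⁻¹]} (hh : h • x = 0) (hph : ¬ LaurentPolynomial.C (p : ℤ) ∣ h) :
    Finite (Submodule.span ℤ[T;T⁻¹] {x}) := by
  have := Fact.mk hp
  obtain ⟨m, q, hq⟩ := h.exists_T_pow
  have hqx : toLaurent q • x = 0 := by rw [hq, mul_comm, mul_smul, hh, smul_zero]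
  have hpq : ¬ Polynomial.C (p : ℤ) ∣ q := by
    rwa [← C_dvd_toLaurent_iff, hq, (LaurentPolynomial.isUnit_T _).dvd_mul_right]
  let φ : Polynomial ℤ →+* Polynomial (ZMod p) := Polynomial.mapRingHom (Int.castRingHom _)
  have hφ : ∀ r, φ r = 0 ↔ Polynomial.C (p : ℤ) ∣ r := by
    intro r
    rw [Polynomial.C_dvd_iff_dvd_coeff, Polynomial.ext_iff]
    simp [φ, ZMod.intCast_zmod_eq_zero_iff_dvd]
  have hφq : φ q ≠ 0 := fun h => hpq ((hφ q).mp h)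
  let f : Polynomial ℤ → N := fun r => toLaurent r • x
  let g : Polynomial ℤ →+* AdjoinRoot (φ q) := (AdjoinRoot.mk (φ q)).comp φ
  have : Module.Finite (ZMod p) (AdjoinRoot (φ q)) := (AdjoinRoot.powerBasis hφq).finite
  have : Finite (AdjoinRoot (φ q)) := Module.finite_of_finite (ZMod p)
  -- Polynomials with the same image in `𝔽_p[t]/(φ q)` differ by an element of the ideal `(q, p)`,
  -- which kills `x`; so `f` takes only finitely many values.
  have hfac : f.FactorsThrough g := by
    intro r₁ r₂ hr
    have h0 : g (r₁ - r₂) = 0 := by rw [map_sub, hr, sub_self]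
    obtain ⟨w, hw⟩ := AdjoinRoot.mk_eq_zero.mp h0
    obtain ⟨w, rfl⟩ := Polynomial.map_surjective (Int.castRingHom (ZMod p))
      (ZMod.ringHom_surjective _) w
    have h1 : φ (r₁ - r₂ - q * w) = 0 := by
      rw [map_sub, hw, map_mul]
      exact sub_self _
    obtain ⟨v, hv⟩ := (hφ _).mp h1
    have h2 : r₁ = r₂ + (w * q + v * Polynomial.C (p : ℤ)) := by linear_combination hv
    simp only [f]
    rw [h2, map_add, map_add, map_mul, map_mul, add_smul, add_smul, mul_smul, mul_smul, hqx,
      Polynomial.toLaurent_C, C_smul, hx]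
    simp
  obtain ⟨e, he⟩ := (Function.factorsThrough_iff f).mp hfac
  have hfin : (Set.range f).Finite := by
    refine (Set.finite_range e).subset ?_
    rintro _ ⟨r, rfl⟩
    exact ⟨g r, by rw [he]; rfl⟩
  have : Finite (Set.range f) := hfin
  have hT : ∀ y ∈ Set.range f, (LaurentPolynomial.T 1 : ℤ[T;T⁻¹]) • y ∈ Set.range f := by
    rintro _ ⟨r, rfl⟩
    exact ⟨Polynomial.X * r, by simp only [f, map_mul, Polynomial.toLaurent_X, mul_smul]⟩
  have hTinv : ∀ (n : ℕ), ∀ y ∈ Set.range f,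
      (LaurentPolynomial.T (-n) : ℤ[T;T⁻¹]) • y ∈ Set.range f := by
    -- Multiplication by `t` is an injective self-map of a finite set, hence surjective, so the set
    -- is also stable under `t⁻¹`.
    have hinj : Function.Injective fun y : Set.range f => (⟨_, hT y y.2⟩ : Set.range f) := by
      rintro ⟨y, hy⟩ ⟨z, hz⟩ hyz
      have := congrArg Subtype.val hyz
      exact Subtype.ext (((LaurentPolynomial.isUnit_T 1).smul_left_cancel).mp this)
    have hsurj := Finite.surjective_of_injective hinj
    intro n
    induction n with
    | zero => simp
    | succ n ih =>
      intro y hy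
      obtain ⟨⟨z, hz⟩, hzy⟩ := hsurj ⟨y, hy⟩
      have hzy' : (LaurentPolynomial.T 1 : ℤ[T;T⁻¹]) • z = y := congrArg Subtype.val hzy
      rw [← hzy', smul_smul, ← LaurentPolynomial.T_add]
      simpa using ih z hz
  refine hfin.subset fun y hy => ?_
  obtain ⟨a, rfl⟩ := Submodule.mem_span_singleton.mp hy
  obtain ⟨n, r, hr⟩ := a.exists_T_pow
  have := hTinv n (f r) ⟨r, rfl⟩
  rwa [show f r = toLaurent r • x from rfl, smul_smul, hr, mul_comm, mul_assoc,
    ← LaurentPolynomial.T_add, add_neg_cancel, LaurentPolynomial.T_zero, mul_one] at this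

/-- The preimage in `M` of a finite submodule is finite, because `zM` is; by maximality it lies in
`zM`. -/
theorem eq_zero_of_finite_span_singleton {M : Type*} [AddCommGroup M] [Module ℤ[T;T⁻¹] M]
    [Module.Finite ℤ[T;T⁻¹] M] {x : M ⧸ maxFinite M}
    (hx : Finite (Submodule.span ℤ[T;T⁻¹] {x})) : x = 0 := by
  obtain ⟨y, rfl⟩ := (maxFinite M).mkQ_surjective x
  have hfin : (maxFinite M : Set M).Finite := (maxFinite_isGreatest M).1
  have h1 : (((Submodule.span ℤ[T;T⁻¹] {(maxFinite M).mkQ y}).comap (maxFinite M).mkQ :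
      Submodule _ M) : Set M).Finite := by
    rw [Submodule.comap_coe]
    refine Set.Finite.preimage' hx fun b _ => ?_
    obtain ⟨z, rfl⟩ := (maxFinite M).mkQ_surjective b
    refine (hfin.image (z + ·)).subset fun w hw => ⟨w - z, ?_, by simp⟩
    exact (Submodule.Quotient.eq _).mp hw
  have h2 := (maxFinite_isGreatest M).2 h1
  exact (Submodule.Quotient.mk_eq_zero _).mpr (h2 (Submodule.mem_span_singleton_self _))

theorem isTorsionFree_quotient_maxFinite {M : Type*} [AddCommGroup M] [Module ℤ[T;T⁻¹] M]
    [Module.Finite ℤ[T;T⁻¹] M]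
    (h : ∀ p : ℕ, p.Prime → ∃ a : ℤ[T;T⁻¹], ¬ LaurentPolynomial.C (p : ℤ) ∣ a ∧ ∀ x : M, a • x = 0)
    {n : ℕ} (hn : n ≠ 0) {x : M ⧸ maxFinite M} (hx : (n : ℤ) • x = 0) : x = 0 := by
  induction n using induction_on_primes generalizing x with
  | zero => exact absurd rfl hn
  | one => simpa using hx
  | prime_mul p a hp ih =>
    refine ih (by rintro rfl; simp at hn) ?_
    rw [Nat.cast_mul, mul_smul] at hx
    obtain ⟨b, hpb, hb⟩ := h p hp
    refine eq_zero_of_finite_span_singleton (finite_span_singleton hp hx (h := b) ?_ hpb)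
    generalize (a : ℤ) • x = z
    obtain ⟨z, rfl⟩ := (maxFinite M).mkQ_surjective z
    rw [← map_smul, hb, map_zero]

/-! ### Lattices generating a module -/

section Tower

variable {N : Type*} [AddCommGroup N]

/-- The subgroup generated by the images of `E` under the first `k` powers of `τ`. -/
def tower (E : Submodule ℤ N) (τ : N →ₗ[ℤ] N) : ℕ → Submodule ℤ N
  | 0 => E
  | k + 1 => tower E τ k ⊔ (tower E τ k).map τ

variable {E : Submodule ℤ N} {τ : N →ₗ[ℤ] N}

theorem tower_monotone : Monotone (tower E τ) :=
  monotone_nat_of_le_succ fun _ => le_sup_left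

theorem tower_fg (hE : E.FG) (k : ℕ) : (tower E τ k).FG := by
  induction k with
  | zero => exact hE
  | succ k ih => exact ih.sup (ih.map τ)

theorem map_mem_tower {k : ℕ} {x : N} (hx : x ∈ tower E τ k) : τ x ∈ tower E τ (k + 1) :=
  (le_sup_right : (tower E τ k).map τ ≤ _) (Submodule.mem_map_of_mem hx)

theorem pow_mem_tower {k : ℕ} {x : N} (hx : x ∈ tower E τ k) (j : ℕ) :
    (τ ^ j) x ∈ tower E τ (k + j) := by
  induction j with
  | zero => simpa
  | succ j ih =>
    rw [pow_succ', Module.End.mul_apply]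
    exact map_mem_tower ih

theorem exists_add_pow_of_mem_tower {k : ℕ} {x : N} (hx : x ∈ tower E τ (k + 1)) :
    ∃ y ∈ tower E τ k, ∃ z ∈ tower E τ 1, x = y + (τ ^ k) z := by
  induction k generalizing x with
  | zero => exact ⟨0, zero_mem _, x, hx, by simp⟩
  | succ k ih =>
    obtain ⟨a, ha, b, ⟨c, hc, rfl⟩, rfl⟩ := Submodule.mem_sup.mp hx
    obtain ⟨y, hy, z, hz, rfl⟩ := ih hc
    refine ⟨a + τ y, add_mem ha (map_mem_tower hy), z, hz, ?_⟩
    rw [pow_succ', Module.End.mul_apply, map_add, add_assoc]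

/-- Since `E_{k+1} = E_k + τ^k E_1`, the question concerns only `z ∈ E_1`. The subgroups `{z ∈ E_1 |
τ^k z ∈ E_k}` increase with `k`, hence stabilize because `E_1` is Noetherian. -/
theorem exists_forall_mem_tower (hE : E.FG) :
    ∃ k₀, ∀ k ≥ k₀, ∀ j, ∀ x ∈ tower E τ (k + 1), (τ ^ j) x ∈ tower E τ (k + j) →
      x ∈ tower E τ k := by
  have : Module.Finite ℤ (tower E τ 1) := Module.Finite.iff_fg.mpr (tower_fg hE 1)
  have hnoeth : IsNoetherian ℤ (tower E τ 1) := isNoetherian_of_isNoetherianRing_of_finite _ _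
  let P : ℕ →o Submodule ℤ (tower E τ 1) :=
    { toFun := fun k => (tower E τ k).comap ((τ ^ k).comp (tower E τ 1).subtype)
      monotone' := monotone_nat_of_le_succ fun k x hx => by
        have h1 : τ ((τ ^ k) x) ∈ tower E τ (k + 1) := map_mem_tower hx
        change (τ ^ (k + 1)) (x : N) ∈ tower E τ (k + 1)
        rwa [pow_succ', Module.End.mul_apply] }
  obtain ⟨k₀, hk₀⟩ := monotone_stabilizes_iff_noetherian.mpr hnoeth P
  refine ⟨k₀, fun k hk j x hx hj => ?_⟩
  obtain ⟨y, hy, z, hz, rfl⟩ := exists_add_pow_of_mem_tower hx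
  refine add_mem hy ?_
  rw [map_add, (tower E τ (k + j)).add_mem_iff_right (pow_mem_tower hy j)] at hj
  have h1 : (⟨z, hz⟩ : tower E τ 1) ∈ P (k + j) := by
    change (τ ^ (k + j)) z ∈ tower E τ (k + j)
    rwa [add_comm k j, pow_add, Module.End.mul_apply, add_comm j k]
  rw [← hk₀ (k + j) (by omega), hk₀ k hk] at h1
  exact h1

/-- In `E_{k+1} = E_k + τ^k E_1`, the relation applied to `τ^(k-m) z` expresses `a m • τ^k z`
through lower powers of `τ`, which already lie in `E_k`. -/
theorem smul_mem_tower {m : ℕ} {a : ℕ → ℤ}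
    (ha : ∀ z, ∑ i ∈ Finset.range (m + 1), a i • (τ ^ i) z = 0) {k : ℕ} (hk : m ≤ k) {x : N}
    (hx : x ∈ tower E τ (k + 1)) : a m • x ∈ tower E τ k := by
  obtain ⟨y, hy, z, hz, rfl⟩ := exists_add_pow_of_mem_tower hx
  rw [smul_add]
  refine add_mem (Submodule.smul_mem _ _ hy) ?_
  obtain ⟨l, rfl⟩ := Nat.exists_eq_add_of_le hk
  have h1 := ha ((τ ^ l) z)
  rw [Finset.sum_range_succ, ← Module.End.mul_apply, ← pow_add] at h1
  rw [eq_neg_of_add_eq_zero_right h1]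
  refine neg_mem (sum_mem fun i hi => Submodule.smul_mem _ _ ?_)
  rw [← Module.End.mul_apply, ← pow_add]
  refine tower_monotone ?_ (pow_mem_tower hz (i + l))
  have := Finset.mem_range.mp hi
  omega

end Tower

variable {N : Type*} [AddCommGroup N] [Module ℤ[T;T⁻¹] N]

/-- The action of `t`, as an endomorphism of the underlying abelian group. -/
def mulT (N : Type*) [AddCommGroup N] [Module ℤ[T;T⁻¹] N] : N →ₗ[ℤ] N :=
  (DistribSMul.toAddMonoidHom N (LaurentPolynomial.T 1 : ℤ[T;T⁻¹])).toIntLinearMap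

theorem mulT_apply (x : N) : mulT N x = (LaurentPolynomial.T 1 : ℤ[T;T⁻¹]) • x := rfl

theorem mulT_pow_apply (k : ℕ) (x : N) :
    (mulT N ^ k) x = (LaurentPolynomial.T k : ℤ[T;T⁻¹]) • x := by
  induction k with
  | zero => simp
  | succ k ih =>
    rw [pow_succ', Module.End.mul_apply, ih, mulT_apply, smul_smul, ← LaurentPolynomial.T_add,
      Nat.cast_succ, add_comm]

theorem toLaurent_smul (q : Polynomial ℤ) (x : N) :
    toLaurent q • x = ∑ i ∈ Finset.range (q.natDegree + 1), q.coeff i • (mulT N ^ i) x := by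
  conv_lhs => rw [q.as_sum_range_C_mul_X_pow]
  rw [map_sum, Finset.sum_smul]
  refine Finset.sum_congr rfl fun i _ => ?_
  rw [Polynomial.toLaurent_C_mul_X_pow, mul_smul, C_smul, mulT_pow_apply]

/-- A lattice of generators with a sublattice of relations between neighbouring translates. -/
theorem exists_lattice [Module.Finite ℤ[T;T⁻¹] N]
    (htf : ∀ n : ℕ, n ≠ 0 → ∀ x : N, (n : ℤ) • x = 0 → x = 0)
    {h : ℤ[T;T⁻¹]} (h0 : h ≠ 0) (hN : ∀ x : N, h • x = 0) :
    ∃ (e : ℕ) (β : (Fin e → ℤ) →+ N) (f g : (Fin e → ℤ) →+ (Fin e → ℤ)),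
      Function.Injective β ∧ Function.Injective f ∧ Function.Injective g ∧
      (∀ u, β (f u) = (LaurentPolynomial.T 1 : ℤ[T;T⁻¹]) • β (g u)) ∧
      Submodule.span ℤ[T;T⁻¹] (Set.range β) = ⊤ ∧
      ∀ (m : ℕ) (b : ℕ → Fin e → ℤ) (y : Fin e → ℤ),
        ∑ i ∈ Finset.range (m + 1), (LaurentPolynomial.T (i : ℤ) : ℤ[T;T⁻¹]) • β (b i) +
          (LaurentPolynomial.T ((m + 1 : ℕ) : ℤ) : ℤ[T;T⁻¹]) • β y = 0 → ∃ u, y = g u := by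
  obtain ⟨s, hs⟩ := (Module.finite_def.mp ‹Module.Finite ℤ[T;T⁻¹] N›)
  let E : Submodule ℤ N := Submodule.span ℤ (s : Set N)
  have hE : E.FG := ⟨s, rfl⟩
  obtain ⟨n, q, hq⟩ := h.exists_T_pow
  have hqN : ∀ x : N, toLaurent q • x = 0 := fun x => by
    rw [hq, mul_comm, mul_smul, hN, smul_zero]
  have hq0 : q ≠ 0 := by
    rw [← Polynomial.toLaurent_ne_zero, hq]
    exact mul_ne_zero h0 (LaurentPolynomial.isUnit_T _).ne_zero
  obtain ⟨k₀, hk₀⟩ := exists_forall_mem_tower (τ := mulT N) hE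
  -- Beyond `k₀` the tower has stabilized in the sense of `hk₀`; beyond the degree of `q` its
  -- leading coefficient carries `B` into `U`.
  let k := max k₀ q.natDegree
  let U := tower E (mulT N) k
  let B := tower E (mulT N) (k + 1)
  have hUB : U ≤ B := tower_monotone k.le_succ
  have hτ : ∀ x ∈ U, mulT N x ∈ B := fun x hx => map_mem_tower hx
  have hlead : ∀ x ∈ B, q.leadingCoeff • x ∈ U := fun x hx =>
    smul_mem_tower (fun z => by rw [← toLaurent_smul, hqN]) (le_max_right _ _) hx
  have htf' : ∀ n : ℤ, n ≠ 0 → ∀ x : N, n • x = 0 → x = 0 := by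
    intro n hn x hx
    refine htf n.natAbs (Int.natAbs_ne_zero.mpr hn) x ?_
    rcases Int.natAbs_eq n with h | h
    · rwa [← h]
    · rwa [h, neg_smul, neg_eq_zero] at hx
  have hfree : ∀ V : Submodule ℤ N, V.FG → Module.Finite ℤ V ∧ Module.Free ℤ V := by
    intro V hV
    have : Module.Finite ℤ V := Module.Finite.iff_fg.mpr hV
    have : Module.IsTorsionFree ℤ V := by
      refine Module.IsTorsionFree.of_smul_eq_zero fun n x hx => ?_
      refine or_iff_not_imp_left.mpr fun hn => Subtype.ext (htf' n hn x ?_)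
      exact congrArg Subtype.val hx
    exact ⟨inferInstance, inferInstance⟩
  obtain ⟨hUfin, hUfree⟩ := hfree U (tower_fg hE _)
  obtain ⟨hBfin, hBfree⟩ := hfree B (tower_fg hE _)
  have hrank : Module.finrank ℤ U = Module.finrank ℤ B := by
    apply le_antisymm
    · exact LinearMap.finrank_le_finrank_of_injective (Submodule.inclusion_injective hUB)
    · let F : B →ₗ[ℤ] U :=
        ((q.leadingCoeff • LinearMap.id : N →ₗ[ℤ] N).comp B.subtype).codRestrict U
          fun x => hlead x x.2
      refine LinearMap.finrank_le_finrank_of_injective (f := F) ?_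
      refine (injective_iff_map_eq_zero F).mpr fun x hx => ?_
      exact Subtype.ext (htf' _ (Polynomial.leadingCoeff_ne_zero.mpr hq0) _
        (congrArg Subtype.val hx))
  let α : (Fin (Module.finrank ℤ B) → ℤ) ≃ₗ[ℤ] U :=
    (Module.finBasisOfFinrankEq ℤ U hrank).equivFun.symm
  let γ : (Fin (Module.finrank ℤ B) → ℤ) ≃ₗ[ℤ] B := (Module.finBasis ℤ B).equivFun.symm
  let f : (Fin (Module.finrank ℤ B) → ℤ) →ₗ[ℤ] (Fin (Module.finrank ℤ B) → ℤ) :=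
    γ.symm.toLinearMap.comp
      ((((mulT N).comp U.subtype).codRestrict B fun x => hτ x x.2).comp α.toLinearMap)
  let g : (Fin (Module.finrank ℤ B) → ℤ) →ₗ[ℤ] (Fin (Module.finrank ℤ B) → ℤ) :=
    γ.symm.toLinearMap.comp ((Submodule.inclusion hUB).comp α.toLinearMap)
  have hf : ∀ u, (γ (f u) : N) = (LaurentPolynomial.T 1 : ℤ[T;T⁻¹]) • (α u : N) := fun u =>
    congrArg Subtype.val (γ.apply_symm_apply _)
  have hg : ∀ u, (γ (g u) : N) = α u := fun u => by simp [g]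
  refine ⟨Module.finrank ℤ B, (B.subtype.comp γ.toLinearMap).toAddMonoidHom,
    f.toAddMonoidHom, g.toAddMonoidHom, ?_, ?_, ?_, ?_, ?_, ?_⟩
  · exact B.subtype_injective.comp γ.injective
  · intro u v huv
    have h1 : (γ (f u) : N) = γ (f v) := congrArg (fun w => (γ w : N)) huv
    rw [hf, hf, (LaurentPolynomial.isUnit_T 1).smul_left_cancel] at h1
    exact α.injective (Subtype.ext h1)
  · intro u v huv
    have h1 : (γ (g u) : N) = γ (g v) := congrArg (fun w => (γ w : N)) huv
    rw [hg, hg] at h1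
    exact α.injective (Subtype.ext h1)
  · intro u
    exact (hf u).trans (by rw [← hg]; rfl)
  · rw [eq_top_iff, ← hs]
    refine Submodule.span_mono fun x hx => ?_
    have hxB : x ∈ B := tower_monotone (Nat.zero_le _) (Submodule.subset_span hx)
    exact ⟨γ.symm ⟨x, hxB⟩, by simp⟩
  · intro m b y hy
    -- The relation puts `t^(m+1) y` into the sum of the `t^i B` with `i ≤ m`, hence into
    -- `E_{k+m+1}`; stabilization then lowers `y` from `E_{k+1}` to `E_k`.
    have hyU : (γ y : N) ∈ U := by
      refine hk₀ k (le_max_left _ _) (m + 1) _ (γ y).2 ?_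
      rw [mulT_pow_apply]
      refine (eq_neg_of_add_eq_zero_right hy) ▸ ?_
      refine neg_mem (sum_mem fun i hi => ?_)
      rw [← mulT_pow_apply]
      refine tower_monotone ?_ (pow_mem_tower (γ (b i)).2 i)
      have := Finset.mem_range.mp hi
      omega
    refine ⟨α.symm ⟨γ y, hyU⟩, γ.injective (Subtype.ext ?_)⟩
    exact ((hg _).trans (by simp)).symm

/-! ### The amalgamated sum of a lattice -/

theorem map_smul_of_map_T_smul {A N : Type*} [AddCommGroup A] [Module ℤ[T;T⁻¹] A]
    [AddCommGroup N] [Module ℤ[T;T⁻¹] N] (φ : A →+ N)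
    (h : ∀ x, φ ((LaurentPolynomial.T 1 : ℤ[T;T⁻¹]) • x) =
      (LaurentPolynomial.T 1 : ℤ[T;T⁻¹]) • φ x) (a : ℤ[T;T⁻¹]) (x : A) :
    φ (a • x) = a • φ x := by
  have hnat : ∀ (n : ℕ) (x : A), φ ((LaurentPolynomial.T n : ℤ[T;T⁻¹]) • x) =
      (LaurentPolynomial.T n : ℤ[T;T⁻¹]) • φ x := by
    intro n
    induction n with
    | zero => simp
    | succ n ih =>
      intro x
      rw [Nat.cast_succ, LaurentPolynomial.T_add, mul_smul, mul_smul, ih, h]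
  have hint : ∀ (n : ℤ) (x : A), φ ((LaurentPolynomial.T n : ℤ[T;T⁻¹]) • x) =
      (LaurentPolynomial.T n : ℤ[T;T⁻¹]) • φ x := by
    intro n x
    obtain ⟨k, rfl | rfl⟩ := n.eq_nat_or_neg
    · exact hnat k x
    · rw [← (LaurentPolynomial.isUnit_T (R := ℤ) k).smul_left_cancel, ← hnat, smul_smul, smul_smul,
        ← LaurentPolynomial.T_add]
      simp
  induction a using LaurentPolynomial.induction_on' with
  | add p q hp hq => rw [add_smul, map_add, hp, hq, add_smul]
  | C_mul_T n c => rw [mul_smul, mul_smul, C_smul, C_smul, map_zsmul, hint]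

section AmalgamMap

variable {U B N : Type*} [AddCommGroup U] [AddCommGroup B] [AddCommGroup N] [Module ℤ[T;T⁻¹] N]

/-- The map of a direct sum of copies of `B` that is given by `t^n β` on the `n`-th copy. -/
def sumMap (β : B →+ N) : (ℤ →₀ B) →+ N :=
  Finsupp.liftAddHom fun n =>
    (DistribSMul.toAddMonoidHom N (LaurentPolynomial.T n : ℤ[T;T⁻¹])).comp β

theorem sumMap_single (β : B →+ N) (n : ℤ) (b : B) :
    sumMap β (Finsupp.single n b) = (LaurentPolynomial.T n : ℤ[T;T⁻¹]) • β b := by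
  simp [sumMap]

theorem sumMap_shiftSum (β : B →+ N) (w : ℤ →₀ B) :
    sumMap β (shiftSum B w) = (LaurentPolynomial.T 1 : ℤ[T;T⁻¹]) • sumMap β w := by
  induction w using Finsupp.induction_linear with
  | zero => simp
  | add v w hv hw => rw [map_add, map_add, map_add, smul_add, hv, hw]
  | single n b =>
    rw [shiftSum_single, sumMap_single, sumMap_single, smul_smul, ← LaurentPolynomial.T_add,
      add_comm]

variable {β : B →+ N} {f g : U →+ B}

theorem amalgamRelators_le_ker
    (hfg : ∀ u, β (f u) = (LaurentPolynomial.T 1 : ℤ[T;T⁻¹]) • β (g u)) :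
    amalgamRelators f g ≤ (sumMap β).ker := by
  refine (AddSubgroup.closure_le _).mpr ?_
  rintro _ ⟨n, u, rfl⟩
  rw [SetLike.mem_coe, AddMonoidHom.mem_ker, map_sub, sumMap_single, sumMap_single, hfg, smul_smul,
    ← LaurentPolynomial.T_add, sub_self]

/-- Descent on the top index: by `hg` the last term is some `g u`, and a relator replaces it by `f
u` one place lower. Injectivity of `β` settles the single term that remains. -/
theorem sum_single_mem_amalgamRelators (hβ : Function.Injective β)
    (hfg : ∀ u, β (f u) = (LaurentPolynomial.T 1 : ℤ[T;T⁻¹]) • β (g u))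
    (hg : ∀ (m : ℕ) (b : ℕ → B) (y : B),
      ∑ i ∈ Finset.range (m + 1), (LaurentPolynomial.T (i : ℤ) : ℤ[T;T⁻¹]) • β (b i) +
        (LaurentPolynomial.T ((m + 1 : ℕ) : ℤ) : ℤ[T;T⁻¹]) • β y = 0 → ∃ u, y = g u)
    (a : ℤ) (b : ℕ → B) (m : ℕ) (y : B)
    (h : ∑ i ∈ Finset.range m, (LaurentPolynomial.T (i : ℤ) : ℤ[T;T⁻¹]) • β (b i) +
      (LaurentPolynomial.T (m : ℤ) : ℤ[T;T⁻¹]) • β y = 0) :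
    ∑ i ∈ Finset.range m, Finsupp.single (a + i) (b i) + Finsupp.single (a + m) y ∈
      amalgamRelators f g := by
  induction m generalizing y with
  | zero =>
    have : y = 0 := by
      apply hβ
      simpa using h
    simp [this, zero_mem]
  | succ m ih =>
    obtain ⟨u, rfl⟩ := hg m b y h
    have h1 := ih (b m + f u) (by
      rw [← h, Finset.sum_range_succ, map_add, hfg, smul_add, smul_smul, ← LaurentPolynomial.T_add,
        Nat.cast_succ, add_assoc])
    have h2 : Finsupp.single (a + m) (f u) - Finsupp.single (a + m + 1) (g u) ∈
        amalgamRelators f g := AddSubgroup.subset_closure ⟨_, u, rfl⟩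
    convert sub_mem h1 h2 using 1
    rw [Finset.sum_range_succ, Finsupp.single_add, Nat.cast_succ, ← add_assoc a]
    abel

theorem amalgamRelators_eq_ker (hβ : Function.Injective β)
    (hfg : ∀ u, β (f u) = (LaurentPolynomial.T 1 : ℤ[T;T⁻¹]) • β (g u))
    (hg : ∀ (m : ℕ) (b : ℕ → B) (y : B),
      ∑ i ∈ Finset.range (m + 1), (LaurentPolynomial.T (i : ℤ) : ℤ[T;T⁻¹]) • β (b i) +
        (LaurentPolynomial.T ((m + 1 : ℕ) : ℤ) : ℤ[T;T⁻¹]) • β y = 0 → ∃ u, y = g u) :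
    amalgamRelators f g = (sumMap β).ker := by
  refine le_antisymm (amalgamRelators_le_ker hfg) fun w hw => ?_
  -- The support lies in the `2K + 1` integers from `-K` to `K`; the unit `t^(-K)` is cancelled
  -- below so that exponents start at `0`.
  let K := w.support.sup Int.natAbs
  have hw' : w = ∑ i ∈ Finset.range (2 * K + 1), Finsupp.single (-K + i : ℤ) (w (-K + i)) := by
    have hsub : w.support ⊆ (Finset.range (2 * K + 1)).image fun i : ℕ => (-K + i : ℤ) := by
      intro n hn
      have : n.natAbs ≤ K := Finset.le_sup (f := Int.natAbs) hn
      exact Finset.mem_image.mpr ⟨(n + K).toNat, Finset.mem_range.mpr (by omega), by omega⟩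
    conv_lhs => rw [← w.sum_single]
    rw [Finsupp.sum_of_support_subset _ hsub _ fun i _ => Finsupp.single_zero i,
      Finset.sum_image fun i _ j _ h => by simpa using h]
  have h0 : sumMap β w = 0 := hw
  rw [Finset.sum_range_succ] at hw'
  rw [hw', map_add, map_sum] at h0
  simp only [sumMap_single, LaurentPolynomial.T_add, mul_smul] at h0
  rw [← Finset.smul_sum, ← smul_add, (LaurentPolynomial.isUnit_T _).smul_eq_zero] at h0
  rw [hw']
  exact sum_single_mem_amalgamRelators hβ hfg hg (-K) (fun i => w (-K + i)) (2 * K) _ h0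

theorem nonempty_amalgam_equiv (hβ : Function.Injective β)
    (hfg : ∀ u, β (f u) = (LaurentPolynomial.T 1 : ℤ[T;T⁻¹]) • β (g u))
    (hspan : Submodule.span ℤ[T;T⁻¹] (Set.range β) = ⊤)
    (hg : ∀ (m : ℕ) (b : ℕ → B) (y : B),
      ∑ i ∈ Finset.range (m + 1), (LaurentPolynomial.T (i : ℤ) : ℤ[T;T⁻¹]) • β (b i) +
        (LaurentPolynomial.T ((m + 1 : ℕ) : ℤ) : ℤ[T;T⁻¹]) • β y = 0 → ∃ u, y = g u) :
    Nonempty (N ≃ₗ[ℤ[T;T⁻¹]] Amalgam f g) := by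
  let ψ : Amalgam f g →+ N :=
    QuotientAddGroup.lift (amalgamRelators f g) (sumMap β) (amalgamRelators_le_ker hfg)
  have hψT : ∀ x, ψ ((LaurentPolynomial.T 1 : ℤ[T;T⁻¹]) • x) =
      (LaurentPolynomial.T 1 : ℤ[T;T⁻¹]) • ψ x := by
    intro x
    rw [Amalgam.T_smul]
    obtain ⟨w, rfl⟩ := QuotientAddGroup.mk'_surjective (amalgamRelators f g) x
    exact sumMap_shiftSum β w
  let Ψ : Amalgam f g →ₗ[ℤ[T;T⁻¹]] N :=
    { ψ with map_smul' := map_smul_of_map_T_smul ψ hψT }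
  have hinj : Function.Injective Ψ := by
    refine (injective_iff_map_eq_zero ψ).mpr fun x hx => ?_
    obtain ⟨w, rfl⟩ := QuotientAddGroup.mk'_surjective (amalgamRelators f g) x
    refine (QuotientAddGroup.eq_zero_iff w).mpr ?_
    rw [amalgamRelators_eq_ker hβ hfg hg]
    exact hx
  have hsurj : Function.Surjective Ψ := by
    rw [← LinearMap.range_eq_top, eq_top_iff, ← hspan, Submodule.span_le]
    rintro _ ⟨b, rfl⟩
    refine ⟨Amalgam.of f g 0 b, ?_⟩
    change sumMap β (Finsupp.single 0 b) = β b
    rw [sumMap_single, LaurentPolynomial.T_zero, one_smul]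
  exact ⟨(LinearEquiv.ofBijective Ψ ⟨hinj, hsurj⟩).symm⟩

end AmalgamMap

/-! ### The presentation matrix `tg - f` and its determinant -/

section Pencil

variable {N : Type*} [AddCommGroup N] [Module ℤ[T;T⁻¹] N] {e : ℕ}

theorem sum_C_smul_single (β : (Fin e → ℤ) →+ N) (b : Fin e → ℤ) :
    ∑ j, (LaurentPolynomial.C (b j) : ℤ[T;T⁻¹]) • β (Pi.single j 1) = β b := by
  conv_rhs => rw [pi_eq_sum_univ' b, map_sum]
  refine Finset.sum_congr rfl fun j _ => ?_
  rw [C_smul, ← map_zsmul]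

theorem apply_eq_sum_mul_single (f : (Fin e → ℤ) →+ (Fin e → ℤ)) (u : Fin e → ℤ) (j : Fin e) :
    f u j = ∑ i, u i * f (Pi.single i 1) j := by
  have h : u = ∑ i, u i • (Pi.single i (1 : ℤ) : Fin e → ℤ) := by
    ext k
    simp [Pi.single_apply]
  conv_lhs => rw [h, map_sum]
  simp only [map_zsmul, Finset.sum_apply, Pi.smul_apply, smul_eq_mul]

/-- The coordinates of an element of the direct sum of copies of the lattice of rank `e`, as a
vector of Laurent polynomials. -/
def coordinates (e : ℕ) : (ℤ →₀ (Fin e → ℤ)) →+ (Fin e → ℤ[T;T⁻¹]) :=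
  Finsupp.liftAddHom fun n =>
    { toFun := fun b j => LaurentPolynomial.C (b j) * LaurentPolynomial.T n
      map_zero' := by ext1 j; simp
      map_add' := fun b c => by ext1 j; simp [add_mul] }

theorem coordinates_single (n : ℤ) (b : Fin e → ℤ) :
    coordinates e (Finsupp.single n b) =
      fun j => LaurentPolynomial.C (b j) * LaurentPolynomial.T n := by
  rw [coordinates, Finsupp.liftAddHom_apply_single]
  rfl

theorem coordinates_surjective : Function.Surjective (coordinates e) := by
  intro v
  have h : ∀ (j : Fin e) (a : ℤ[T;T⁻¹]), Pi.single j a ∈ (coordinates e).range := by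
    intro j a
    induction a using LaurentPolynomial.induction_on' with
    | add p q hp hq => rw [Pi.single_add]; exact add_mem hp hq
    | C_mul_T n c =>
      refine ⟨Finsupp.single n (Pi.single j c), ?_⟩
      rw [coordinates_single]
      ext1 i
      by_cases hij : i = j
      · subst hij; simp
      · simp [hij]
  have hv : v ∈ (coordinates e).range := by
    rw [← Finset.univ_sum_single v]
    exact sum_mem fun j _ => h j _
  exact hv

theorem sum_coordinates_smul (β : (Fin e → ℤ) →+ N) (w : ℤ →₀ (Fin e → ℤ)) :
    ∑ j, coordinates e w j • β (Pi.single j 1) = sumMap β w := by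
  induction w using Finsupp.induction_linear with
  | zero => simp
  | add v w hv hw => simp [add_smul, Finset.sum_add_distrib, hv, hw]
  | single n b =>
    rw [coordinates_single, sumMap_single, ← sum_C_smul_single β b, Finset.smul_sum]
    refine Finset.sum_congr rfl fun j _ => ?_
    rw [smul_smul, mul_comm]

/-- The module is presented by the matrix `tg - f`. -/
theorem sum_smul_eq_zero_iff_mem_range_pencil {β : (Fin e → ℤ) →+ N}
    {f g : (Fin e → ℤ) →+ (Fin e → ℤ)}
    (hfg : ∀ u, β (f u) = (LaurentPolynomial.T 1 : ℤ[T;T⁻¹]) • β (g u))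
    (hker : amalgamRelators f g = (sumMap β).ker) (v : Fin e → ℤ[T;T⁻¹]) :
    ∑ j, v j • β (Pi.single j 1) = 0 ↔ v ∈ LinearMap.range (pencil f g).transpose.vecMulLinear := by
  constructor
  · intro hv
    obtain ⟨w, rfl⟩ := coordinates_surjective v
    rw [sum_coordinates_smul, ← AddMonoidHom.mem_ker, ← hker] at hv
    induction hv using AddSubgroup.closure_induction with
    | mem x hx =>
      obtain ⟨n, u, rfl⟩ := hx
      -- In coordinates the relator `f(u)_n - g(u)_(n+1)` is `-t^n (tg - f) u`; the transpose
      -- appears because presentation matrices act on row vectors.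
      refine ⟨fun i => -(LaurentPolynomial.T n * LaurentPolynomial.C (u i)), ?_⟩
      ext1 j
      rw [map_sub, coordinates_single, coordinates_single, Matrix.vecMulLinear_apply,
        Matrix.vecMul, dotProduct, Pi.sub_apply, apply_eq_sum_mul_single f, apply_eq_sum_mul_single g, map_sum, map_sum,
        Finset.sum_mul, Finset.sum_mul, ← Finset.sum_sub_distrib]
      refine Finset.sum_congr rfl fun i _ => ?_
      rw [Matrix.transpose_apply, pencil, Matrix.of_apply, map_mul, map_mul,
        LaurentPolynomial.T_add]
      ring
    | zero => rw [map_zero]; exact zero_mem _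
    | add x y _ _ hx hy => rw [map_add]; exact add_mem hx hy
    | neg x _ hx => rw [map_neg]; exact neg_mem hx
  · rintro ⟨w, rfl⟩
    have h : ∀ i, ∑ j, pencil f g j i • β (Pi.single j 1) = 0 := by
      intro i
      simp only [pencil, Matrix.of_apply, sub_smul, mul_smul, Finset.sum_sub_distrib]
      rw [← Finset.smul_sum, sum_C_smul_single, sum_C_smul_single, hfg, sub_self]
    simp only [Matrix.vecMulLinear_apply, Matrix.vecMul, dotProduct, Finset.sum_smul, mul_smul,
      Matrix.transpose_apply]
    rw [Finset.sum_comm]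
    simp only [← Finset.smul_sum, h, smul_zero, Finset.sum_const_zero]

/-- The matrix of an endomorphism of a lattice in the standard basis. -/
def endMatrix (f : (Fin e → ℤ) →+ (Fin e → ℤ)) : Matrix (Fin e) (Fin e) ℤ :=
  .of fun i j => f (Pi.single j 1) i

theorem det_pencil (f g : (Fin e → ℤ) →+ (Fin e → ℤ)) :
    (pencil f g).det = toLaurent ((Polynomial.X : Polynomial ℤ) • (endMatrix g).map Polynomial.C +
      (-endMatrix f).map Polynomial.C).det := by
  rw [RingHom.map_det]
  congr 1
  ext1 i j
  simp [pencil, endMatrix, sub_eq_add_neg]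

theorem toMatrix'_eq_endMatrix (f : (Fin e → ℤ) →+ (Fin e → ℤ)) :
    LinearMap.toMatrix' f.toIntLinearMap = endMatrix f := by
  ext i j
  simp [endMatrix, LinearMap.toMatrix'_apply]

theorem index_range_eq_natAbs_det {f : (Fin e → ℤ) →+ (Fin e → ℤ)} (hf : Function.Injective f) :
    f.range.index = (endMatrix f).det.natAbs := by
  have h := Submodule.natAbs_det_equiv (LinearMap.range f.toIntLinearMap)
    (LinearEquiv.ofInjective f.toIntLinearMap hf)
  rw [← toMatrix'_eq_endMatrix, LinearMap.det_toMatrix']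
  exact h.symm

theorem det_endMatrix_ne_zero {f : (Fin e → ℤ) →+ (Fin e → ℤ)} (hf : Function.Injective f) :
    (endMatrix f).det ≠ 0 := by
  intro h
  obtain ⟨v, hv, hv0⟩ := Matrix.exists_mulVec_eq_zero_iff.mpr h
  rw [← toMatrix'_eq_endMatrix, LinearMap.toMatrix'_mulVec] at hv0
  exact hv (hf (hv0.trans (map_zero f).symm))

end Pencil

/-! ### Comparison of orders -/

/-- Clearing denominators introduces only a power of `X`, and the prime `X` does not divide `p`, so
that power can be cancelled. -/
theorem dvd_of_toLaurent_dvd {p q : Polynomial ℤ} (hp : p.coeff 0 ≠ 0)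
    (h : toLaurent p ∣ toLaurent q) : p ∣ q := by
  obtain ⟨a, ha⟩ := h
  obtain ⟨n, r, hr⟩ := a.exists_T_pow
  have h1 : p * r = q * Polynomial.X ^ n := by
    apply Polynomial.toLaurent_injective
    rw [map_mul, map_mul, hr, ha, Polynomial.toLaurent_X_pow, mul_assoc]
  have hX : ¬ Polynomial.X ∣ p := fun h => hp (Polynomial.X_dvd_iff.mp h)
  obtain ⟨s, rfl⟩ := Polynomial.prime_X.pow_dvd_of_dvd_mul_left n hX (Dvd.intro_left q h1.symm)
  refine ⟨s, mul_right_cancel₀ (pow_ne_zero n Polynomial.X_ne_zero) ?_⟩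
  rw [← h1]
  ring

/-- Nonzero constant terms exclude a shift by `t^i`, so the two polynomials are associated in
`ℤ[X]`, whose units are `±1`. -/
theorem natDegree_eq_and_natAbs_coeff_eq {p q : Polynomial ℤ} (hp : p.coeff 0 ≠ 0)
    (hq : q.coeff 0 ≠ 0) (h : Associated (toLaurent p) (toLaurent q)) :
    p.natDegree = q.natDegree ∧ ∀ k, (p.coeff k).natAbs = (q.coeff k).natAbs := by
  obtain ⟨u, hu⟩ := associated_of_dvd_dvd (dvd_of_toLaurent_dvd hp h.dvd)
    (dvd_of_toLaurent_dvd hq h.symm.dvd)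
  obtain ⟨c, hc, hcu⟩ := Polynomial.isUnit_iff.mp u.isUnit
  rw [← hcu] at hu
  rcases Int.isUnit_iff.mp hc with rfl | rfl
  · rw [← hu]; simp
  · rw [← hu]; simp

theorem toLaurent_sum {d : ℕ} (c : Fin (d + 1) → ℤ) :
    toLaurent (∑ i : Fin (d + 1), Polynomial.C (c i) * Polynomial.X ^ (i : ℕ)) =
      ∑ i : Fin (d + 1), LaurentPolynomial.C (c i) * LaurentPolynomial.T ((i : ℕ) : ℤ) := by
  simp [map_sum]

theorem coeff_sum_C_mul_X_pow {d : ℕ} (c : Fin (d + 1) → ℤ) (i : Fin (d + 1)) :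
    (∑ i : Fin (d + 1), Polynomial.C (c i) * Polynomial.X ^ (i : ℕ)).coeff i = c i := by
  simp [Polynomial.finsetSum_coeff, Polynomial.coeff_X_pow, Fin.val_inj]

theorem natDegree_sum_C_mul_X_pow_le {d : ℕ} (c : Fin (d + 1) → ℤ) :
    (∑ i : Fin (d + 1), Polynomial.C (c i) * Polynomial.X ^ (i : ℕ)).natDegree ≤ d :=
  Polynomial.natDegree_sum_le_of_forall_le _ _ fun i _ =>
    (Polynomial.natDegree_C_mul_X_pow_le _ _).trans (Nat.lt_succ_iff.mp i.2)

/-- The order in terms of the Fitting ideal of a family of generators. -/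
theorem IsOrder.exists_generators {M : Type*} [AddCommGroup M] [Module ℤ[T;T⁻¹] M]
    {δ : ℤ[T;T⁻¹]} (h : IsOrder M δ) :
    ∃ (s : ℕ) (x : Fin s → M), Submodule.span ℤ[T;T⁻¹] (Set.range x) = ⊤ ∧
      ∀ a, a ∣ δ ↔ ∀ y ∈ fittingIdeal (R := ℤ[T;T⁻¹]) x, a ∣ y := by
  obtain ⟨r, s, A, -, ⟨E⟩, hA⟩ := h
  let F : (Fin s → ℤ[T;T⁻¹]) →ₗ[ℤ[T;T⁻¹]] M :=
    E.toLinearMap.comp (LinearMap.range A.vecMulLinear).mkQ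
  have hF : ∀ v, ∑ j, v j • F (Pi.single j 1) = F v := by
    intro v
    conv_rhs => rw [← Finset.univ_sum_single v, map_sum]
    refine Finset.sum_congr rfl fun j _ => ?_
    rw [← map_smul, ← Pi.single_smul, smul_eq_mul, mul_one]
  refine ⟨s, fun j => F (Pi.single j 1), ?_, fun a => ?_⟩
  · rw [eq_top_iff]
    rintro y -
    obtain ⟨v, rfl⟩ : ∃ v, F v = y :=
      (E.surjective.comp (Submodule.mkQ_surjective _)) y
    exact (Submodule.mem_span_range_iff_exists_fun _).mpr ⟨v, hF v⟩
  · rw [hA, dvd_fittingIdeal_iff_dvd_minors A]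
    intro v
    rw [hF]
    simp [F]

/-- Passing to the quotient by a submodule annihilated by an integer that is coprime to the order
does not change the order. -/
theorem dvd_fittingIdeal_mkQ_iff {M : Type*} [AddCommGroup M] [Module ℤ[T;T⁻¹] M]
    {δ : ℤ[T;T⁻¹]} (hδ : ∀ p : ℕ, p.Prime → ¬ LaurentPolynomial.C (p : ℤ) ∣ δ)
    {s : ℕ} {x : Fin s → M} (hx : ∀ a, a ∣ δ ↔ ∀ y ∈ fittingIdeal (R := ℤ[T;T⁻¹]) x, a ∣ y)
    (Z : Submodule ℤ[T;T⁻¹] M) [Finite Z] (a : ℤ[T;T⁻¹]) :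
    a ∣ δ ↔ ∀ y ∈ fittingIdeal (R := ℤ[T;T⁻¹]) (fun j => Z.mkQ (x j)), a ∣ y := by
  have hsum : ∀ v : Fin s → ℤ[T;T⁻¹], ∑ j, v j • Z.mkQ (x j) = 0 ↔ ∑ j, v j • x j ∈ Z := by
    intro v
    rw [← Submodule.Quotient.mk_eq_zero, ← Submodule.mkQ_apply, map_sum]
    simp only [map_smul]
  constructor
  · intro ha
    refine dvd_fittingIdeal_iff.mpr fun V hV => ha.trans ?_
    have hn : Nat.card Z ≠ 0 := Nat.card_pos.ne'
    refine dvd_of_dvd_C_mul hδ (pow_ne_zero s hn) ?_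
    -- The rows of `V` are relations modulo `Z`; multiplied by `|Z|` they become relations in `M`,
    -- at the cost of a factor `|Z|^s` in the determinant, which is coprime to `δ`.
    have h1 := dvd_fittingIdeal_iff.mp ((hx δ).mp dvd_rfl)
      ((LaurentPolynomial.C (Nat.card Z : ℤ) : ℤ[T;T⁻¹]) • V) fun i => by
        have h2 := (hsum _).mp (hV i)
        have h3 : Nat.card Z • (⟨_, h2⟩ : Z) = 0 := card_nsmul_eq_zero'
        simp only [Matrix.smul_apply, smul_assoc, ← Finset.smul_sum]
        rw [C_smul, natCast_zsmul]
        exact congrArg Subtype.val h3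
    rw [Matrix.det_smul, Fintype.card_fin] at h1
    rwa [Nat.cast_pow, map_pow]
  · intro h
    refine (hx a).mpr (dvd_fittingIdeal_iff.mpr fun V hV =>
      dvd_fittingIdeal_iff.mp h V fun i => ?_)
    rw [hsum, hV i]
    exact zero_mem _

end LaurentModule

end

theorem corollary2p4 (M : Type*) [AddCommGroup M] [Module ℤ[T;T⁻¹] M] [Module.Finite ℤ[T;T⁻¹] M]
    (d : ℕ) (c : Fin (d + 1) → ℤ)
    (hΔ : LaurentModule.IsOrder M
      (∑ i : Fin (d + 1), LaurentPolynomial.C (c i) * LaurentPolynomial.T ((i : ℕ) : ℤ)))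
    (hc : c 0 * c (Fin.last d) ≠ 0)
    (hgcd : Finset.univ.gcd c = 1) :
    ∃ f g : (Fin d → ℤ) →+ (Fin d → ℤ),
      Function.Injective f ∧ Function.Injective g ∧
      Nonempty ((M ⧸ LaurentModule.maxFinite M) ≃ₗ[ℤ[T;T⁻¹]] LaurentModule.Amalgam f g) ∧
      Associated
        (∑ i : Fin (d + 1), LaurentPolynomial.C (c i) * LaurentPolynomial.T ((i : ℕ) : ℤ))
        (LaurentModule.pencil f g).det ∧
      (c 0).natAbs = f.range.index ∧
      (c (Fin.last d)).natAbs = g.range.index := by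
  open LaurentModule in
  have : Finite (maxFinite M) := (maxFinite_isGreatest M).1
  obtain ⟨hc0, hcd⟩ := mul_ne_zero_iff.mp hc
  set δ : ℤ[T;T⁻¹] :=
    ∑ i : Fin (d + 1), LaurentPolynomial.C (c i) * LaurentPolynomial.T ((i : ℕ) : ℤ) with hδdef
  set q : Polynomial ℤ :=
    ∑ i : Fin (d + 1), Polynomial.C (c i) * Polynomial.X ^ (i : ℕ) with hqdef
  have hqδ : Polynomial.toLaurent q = δ := toLaurent_sum c
  have hqc : ∀ i : Fin (d + 1), q.coeff i = c i := coeff_sum_C_mul_X_pow c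
  have hq0 : q.coeff 0 ≠ 0 := by
    have := hqc 0
    rw [Fin.val_zero] at this
    rwa [this]
  have hqd : q.coeff d = c (Fin.last d) := by
    have := hqc (Fin.last d)
    rwa [Fin.val_last] at this
  have hδp : ∀ p : ℕ, p.Prime → ¬ LaurentPolynomial.C (p : ℤ) ∣ δ := by
    intro p hp h
    rw [← hqδ, C_dvd_toLaurent_iff, Polynomial.C_dvd_iff_dvd_coeff] at h
    have h1 : (p : ℤ) ∣ Finset.univ.gcd c := Finset.dvd_gcd fun i _ => hqc i ▸ h i
    rw [hgcd] at h1
    exact (Nat.prime_iff_prime_int.mp hp).not_isUnit (isUnit_of_dvd_one h1)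
  obtain ⟨s, x, hxspan, hx⟩ := hΔ.exists_generators
  have hann : ∀ p : ℕ, p.Prime →
      ∃ a : ℤ[T;T⁻¹], ¬ LaurentPolynomial.C (p : ℤ) ∣ a ∧ ∀ y : M, a • y = 0 := by
    intro p hp
    -- The Fitting ideal need not contain `δ`, but if `p` divided all its elements, it would divide
    -- their greatest common divisor `δ`.
    have h := mt (hx _).mpr (hδp p hp)
    push Not at h
    obtain ⟨a, ha, hpa⟩ := h
    exact ⟨a, hpa, fittingIdeal_smul_eq_zero x hxspan ha⟩
  -- Any prime would do: only a nonzero annihilator of `M` is needed.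
  obtain ⟨h, hh, hhM⟩ := hann 2 Nat.prime_two
  obtain ⟨e, β, f, g, hβ, hf, hg, hfg, hspan, hrel⟩ :=
    exists_lattice (N := M ⧸ maxFinite M) (h := h)
      (fun n hn y hy => isTorsionFree_quotient_maxFinite hann hn hy)
      (by rintro rfl; exact hh (dvd_zero _))
      (fun y => by
        obtain ⟨z, rfl⟩ := (maxFinite M).mkQ_surjective y
        rw [← map_smul, hhM, map_zero])
  have hβspan : Submodule.span ℤ[T;T⁻¹] (Set.range fun j => β (Pi.single j 1)) = ⊤ := by
    rw [eq_top_iff, ← hspan, Submodule.span_le]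
    rintro _ ⟨b, rfl⟩
    exact (Submodule.mem_span_range_iff_exists_fun _).mpr ⟨_, sum_C_smul_single β b⟩
  have hxspan' : Submodule.span ℤ[T;T⁻¹] (Set.range fun j => (maxFinite M).mkQ (x j)) = ⊤ := by
    have h1 := congrArg (Submodule.map (maxFinite M).mkQ) hxspan
    rw [Submodule.map_span, Submodule.map_top, Submodule.range_mkQ, ← Set.range_comp] at h1
    exact h1
  have hass : Associated δ (pencil f g).det := by
    have h1 : ∀ a, a ∣ δ ↔ a ∣ (pencil f g).det := by
      intro a
      rw [dvd_fittingIdeal_mkQ_iff hδp hx (maxFinite M) a,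
        fittingIdeal_eq_of_span_eq_top _ _ hxspan' hβspan,
        fittingIdeal_eq_span_det _ _ (sum_smul_eq_zero_iff_mem_range_pencil hfg
          (amalgamRelators_eq_ker hβ hfg hrel)), Matrix.det_transpose]
      refine ⟨fun h => h _ (Ideal.mem_span_singleton_self _), fun h y hy => ?_⟩
      exact h.trans (Ideal.mem_span_singleton.mp hy)
    exact associated_of_dvd_dvd ((h1 _).mp dvd_rfl) ((h1 _).mpr dvd_rfl)
  have hass' := hass
  rw [det_pencil, ← hqδ] at hass'
  set P := ((Polynomial.X : Polynomial ℤ) • (endMatrix g).map Polynomial.C +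
      (-endMatrix f).map Polynomial.C).det with hP
  have hP0 : (P.coeff 0).natAbs = f.range.index := by
    rw [hP, Polynomial.coeff_det_X_add_C_zero, Matrix.det_neg, index_range_eq_natAbs_det hf,
      Int.natAbs_mul, Int.natAbs_pow, Int.natAbs_neg, Int.natAbs_one, one_pow, one_mul]
  have hPe : P.coeff e = (endMatrix g).det := by
    have := Polynomial.coeff_det_X_add_C_card (endMatrix g) (-endMatrix f)
    rwa [Fintype.card_fin] at this
  have hP0' : P.coeff 0 ≠ 0 := by
    rw [← Int.natAbs_ne_zero, hP0, index_range_eq_natAbs_det hf, Int.natAbs_ne_zero]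
    exact det_endMatrix_ne_zero hf
  have hPdeg : P.natDegree = e := by
    refine le_antisymm ?_ (Polynomial.le_natDegree_of_ne_zero ?_)
    · have := Polynomial.natDegree_det_X_add_C_le (endMatrix g) (-endMatrix f)
      rwa [Fintype.card_fin] at this
    · rw [hPe]
      exact det_endMatrix_ne_zero hg
  have hqdeg : q.natDegree = d := by
    refine le_antisymm (natDegree_sum_C_mul_X_pow_le c) (Polynomial.le_natDegree_of_ne_zero ?_)
    rwa [hqd]
  obtain ⟨hdeg, hcoeff⟩ := natDegree_eq_and_natAbs_coeff_eq hq0 hP0' hass'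
  -- The rank `e` of the lattice depended on choices; only the degree of the determinant identifies
  -- it with `d`.
  obtain rfl : d = e := by rw [← hqdeg, hdeg, hPdeg]
  refine ⟨f, g, hf, hg, nonempty_amalgam_equiv hβ hfg hspan hrel, hass, ?_, ?_⟩
  · rw [← hP0, ← hcoeff, ← hqc 0, Fin.val_zero]
  · rw [index_range_eq_natAbs_det hg, ← hPe, ← hcoeff, hqd]
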